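/- Let $K\ge 2$ and let $n_{\rm d},n_{\rm i}\ge 0$ be integers, $m:=\max\{n_{\rm d},n_{\rm i}\}$. In the symmetric linear deterministic $K$-user channel the inputs $X_1,\dots,X_K$ and outputs $Y_1,\dots,Y_K$ are vectors in $\mathbb F_2^m$ and $$Y_\ell=\mathbf S^{m-n_{\rm d}}X_\ell+\sum_{i\ne\ell}\mathbf S^{m-n_{\rm i}}X_i ,\qquad \ell\in[1:K],$$ where $\mathbf S$ is the $m\times m$ binary shift matrix (ones exactly on the first subdiagonal). The messages $W_1,\dots,W_K$ are independent and $W_i$ is uniform on $[1:\lceil 2^{NR_i}\rceil]$; a code of block length $N$ consists of encoders and of decoders $\widehat W_\ell=g_\ell(Y_\ell^N)$, and its error probability is $\max_\ell\mathbb P[\widehat W_\ell\ne W_\ell]$. With cumulative message sharing, $X_i^N$ is a function of $(W_1,\dots,W_i)$; with cognition only at transmitter $K$, $X_i^N$ is a function of $W_i$ for $i<K$ and $X_K^N$ is a function of $(W_1,\dots,W_K)$. A tuple $(R_1,\dots,R_K)$ of non-negative rates is achievable if there are codes for all block lengths $N$ whose error probability tends to $0$ as $N\to\infty$; the sum-capacity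 is the maximum of $R_1+\dots+R_K$ over the achievable tuples. Then the sum-capacity $C$ with cumulative message sharing exists and equals the sum-rate outer bound $$\max_{P_{X_1,\dots,X_K}}\ \sum_{j=1}^{K} I\big(Y_j;X_j,\dots,X_K\,\big|\,X_1,\dots,X_{j-1},Y_1,\dots,Y_{j-1}\big)$$ (mutual information in bits, maximum over all joint input distributions). Its value is $C=K\max\{n_{\rm d},n_{\rm i}\}-n_{\rm i}$ if $n_{\rm d}\ne n_{\rm i}$ and $C=n_{\rm d}$ if $n_{\rm d}=n_{\rm i}$; that is, if $n_{\rm d}>0$ and $n_{\rm i}=\alpha n_{\rm d}$, then $C/n_{\rm d}=K\max\{1,\alpha\}-\alpha$ for $\alpha\ne 1$ and $C/n_{\rm d}=1$ for $\alpha=1$. Moreover, $C$ is also the sum-capacity with cognition only at transmitter $K$, and there it is achieved by linear codes without error: there are integers $k_1,\dots,k_K\ge 0$ with $k_1+\dots+k_K=C$ such that $(k_1,\dots,k_K)$ is achievable and, for every $N$, there is a code of block length $N$ with cognition only at transmitter $K$, with messages $W_i\in\mathbb F_2^{Nk_i}$, with all encoders and decoders $\mathbb F_2$-linear, and with error probability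 $0$. -/

import Mathlib

namespace CIFC

/-! ### The linear deterministic channel -/

/-- The binary shift matrix of dimension `m`: ones on the first subdiagonal, zeros elsewhere. -/
def shift (m : ℕ) : Matrix (Fin m) (Fin m) (ZMod 2) :=
  Matrix.of fun a b => if (a : ℕ) = (b : ℕ) + 1 then 1 else 0

/-- `m = max n_{ℓ i}`, the number of bit levels for the gains `n`. -/
def levels {K : ℕ} (n : Fin K → Fin K → ℕ) : ℕ :=
  Finset.univ.sup fun p : Fin K × Fin K => n p.1 p.2

/-- Input and output alphabet: binary vectors of dimension `m`. -/
abbrev Sig {K : ℕ} (n : Fin K → Fin K → ℕ) : Type := Fin (levels n) → ZMod 2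

/-- The signal at receiver `l`: `Y_l = ∑ i, S ^ (m - n l i) X_i`. -/
def output {K : ℕ} (n : Fin K → Fin K → ℕ) (l : Fin K) (x : Fin K → Sig n) : Sig n :=
  ∑ i, (shift (levels n) ^ (levels n - n l i)).mulVec (x i)

/-- Symmetric gains: `nd` on the direct links, `ni` on the interfering links. -/
def symGain (K nd ni : ℕ) (l i : Fin K) : ℕ := if l = i then nd else ni

/-! ### Message knowledge, codes and capacity -/

/-- Cumulative message sharing: transmitter `i` knows the messages of users `j ≤ i`. -/
def cms (K : ℕ) (i : Fin K) : Finset (Fin K) := Finset.univ.filter fun j => j ≤ i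

/-- The last transmitter knows all messages; every other one knows only its own. -/
def lastOnly (K : ℕ) (i : Fin K) : Finset (Fin K) :=
  if (i : ℕ) + 1 = K then Finset.univ else {i}

/-- A block code of length `N` with message sets `M j`, where transmitter `i` encodes the messages
with index in `A i`. -/
structure Code {K : ℕ} (n : Fin K → Fin K → ℕ) (A : Fin K → Finset (Fin K))
    (M : Fin K → Type) (N : ℕ) where
  enc : ∀ i, (∀ j : {j // j ∈ A i}, M j.1) → (Fin N → Sig n)
  dec : ∀ l, (Fin N → Sig n) → M l

namespace Code

variable {K : ℕ} {n : Fin K → Fin K → ℕ} {A : Fin K → Finset (Fin K)} {M : Fin K → Type} {N : ℕ}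

/-- The block received at receiver `l` when the messages are `w`. -/
def received (c : Code n A M N) (w : ∀ j, M j) (l : Fin K) : Fin N → Sig n :=
  fun t => output n l fun i => c.enc i (fun j => w j.1) t

/-- Error probability of receiver `l` for independent, uniformly distributed messages. -/
noncomputable def errorAt (c : Code n A M N) (l : Fin K) : ℝ :=
  (Nat.card {w : ∀ j, M j // c.dec l (c.received w l) ≠ w l} : ℝ) / (Nat.card (∀ j, M j) : ℝ)

/-- The largest error probability among the receivers. -/
noncomputable def errorProb (c : Code n A M N) : ℝ := ⨆ l, c.errorAt l

/-- All encoders and decoders are linear over the binary field. -/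
def IsLinear [∀ j, AddCommMonoid (M j)] [∀ j, Module (ZMod 2) (M j)] (c : Code n A M N) : Prop :=
  (∀ i, IsLinearMap (ZMod 2) (c.enc i)) ∧ ∀ l, IsLinearMap (ZMod 2) (c.dec l)

end Code

/-- The non-negative rate tuples `R` for which there is a sequence of codes, one for each block
length `N`, with `⌈2 ^ (N R_i)⌉` messages for user `i` and error probability tending to zero. -/
def capacityRegion {K : ℕ} (n : Fin K → Fin K → ℕ) (A : Fin K → Finset (Fin K)) :
    Set (Fin K → ℝ) :=
  {R | (∀ i, 0 ≤ R i) ∧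
    ∃ c : ∀ N : ℕ, Code n A (fun i => Fin ⌈(2 : ℝ) ^ ((N : ℝ) * R i)⌉₊) N,
      Filter.Tendsto (fun N => (c N).errorProb) Filter.atTop (nhds 0)}

/-- `C` is the maximum of `R_1 + ⋯ + R_K` over the capacity region. -/
def IsSumCapacity {K : ℕ} (n : Fin K → Fin K → ℕ) (A : Fin K → Finset (Fin K)) (C : ℝ) : Prop :=
  IsGreatest ((fun R : Fin K → ℝ => ∑ i, R i) '' capacityRegion n A) C

/-! ### The sum-rate outer bound -/

/-- Shannon entropy, in bits, of the random variable `f` under the law `P`. -/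
noncomputable def entropy {α β : Type} [Fintype β] (P : PMF α) (f : α → β) : ℝ :=
  ∑ b, Real.negMulLog (P.map f b).toReal / Real.log 2

/-- Conditional mutual information `I(f; g | h)`, in bits. -/
noncomputable def condMutualInfo {α β γ δ : Type} [Fintype β] [Fintype γ] [Fintype δ]
    (P : PMF α) (f : α → β) (g : α → γ) (h : α → δ) : ℝ :=
  entropy P (fun a => (f a, h a)) + entropy P (fun a => (g a, h a))
    - entropy P (fun a => (f a, g a, h a)) - entropy P h

/-- The sum-rate bound
`∑ j, I(Y_j; X_j, …, X_K | X_1, …, X_{j-1}, Y_1, …, Y_{j-1})` at the joint input law `P`. -/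
noncomputable def sumRateBound {K : ℕ} (n : Fin K → Fin K → ℕ) (P : PMF (Fin K → Sig n)) : ℝ :=
  ∑ j : Fin K, condMutualInfo P
    (fun x => output n j x)
    (fun x => fun i : {i : Fin K // j ≤ i} => x i.1)
    (fun x => ((fun i : {i : Fin K // i < j} => x i.1),
      (fun i : {i : Fin K // i < j} => output n i.1 x)))

/-- `C` is the maximum of the sum-rate bound over all joint input laws. -/
def IsSumRateOuterBound {K : ℕ} (n : Fin K → Fin K → ℕ) (C : ℝ) : Prop :=
  IsGreatest (Set.range fun P : PMF (Fin K → Sig n) => sumRateBound n P) C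

end CIFC

/-! Both bounds reduce to counting levels. Suppose `s j` is a set of levels of `Y_j` with two
properties (`IsInnovation`): the earlier inputs and outputs together with these levels determine
`Y_j`, and some input perturbation changes these levels at will while leaving the earlier inputs and
outputs alone. The first property bounds the `j`-th mutual information by `|s j|` bits. The second
makes the uniform law attain this bound, so the outer bound equals `∑ |s j|`.

The first property also gives the operational converse without Fano's inequality. Under cumulative
sharing, correctly decoding the earlier messages reveals the earlier inputs, so innovation levels
recover all blocks one after another (`eq_of_innovation_eq`), and at most `2 ^ (N ∑ |s j|)` message
tuples are decoded correctly.

Over the binary field, `Y_l = (S^(m-nd) + S^(m-ni)) X_l + S^(m-ni) ∑ X_i`. For `nd ≠ ni` the first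
matrix is identity plus nilpotent, hence invertible. Transmitter `K` makes `∑ X_i` a signal that the
interfering links erase: the other receivers get `m` clean levels each, and receiver `K` gets `m -
ni` by precoding. For `nd = ni` all outputs equal `∑ X_i`, and one user takes all `nd` levels. -/

namespace CIFC

/-! ### Entropy of finite random variables -/

section Entropy

variable {α β γ δ : Type} [Fintype β]

lemma toReal_map_apply [DecidableEq γ] (Q : PMF β) (φ : β → γ) (c : γ) :
    (Q.map φ c).toReal = ∑ b, if c = φ b then (Q b).toReal else 0 := by
  rw [PMF.map_apply, tsum_fintype, ENNReal.toReal_sum]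
  · refine Finset.sum_congr rfl fun b _ => ?_
    by_cases h : c = φ b <;> simp [h]
  · intro b _
    split_ifs
    · exact Q.apply_ne_top b
    · exact ENNReal.zero_ne_top

lemma sum_toReal_eq_one (Q : PMF β) : ∑ b, (Q b).toReal = 1 := by
  rw [← ENNReal.toReal_sum fun b _ => Q.apply_ne_top b, ← tsum_fintype (L := .unconditional β),
    Q.tsum_coe, ENNReal.toReal_one]

variable [Fintype γ] [Fintype δ]

/-- Merging atoms cannot raise entropy: the logarithm of each positive atom is at most that of the
total. -/
lemma negMulLog_sum_le {ι : Type} (s : Finset ι) (q : ι → ℝ) (hq : ∀ i ∈ s, 0 ≤ q i) :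
    Real.negMulLog (∑ i ∈ s, q i) ≤ ∑ i ∈ s, Real.negMulLog (q i) := by
  rw [Real.negMulLog, neg_mul, Finset.sum_mul, ← Finset.sum_neg_distrib]
  refine Finset.sum_le_sum fun i hi => ?_
  rw [Real.negMulLog, neg_mul, neg_le_neg_iff]
  rcases (hq i hi).eq_or_lt with h | h
  · simp [← h]
  · exact mul_le_mul_of_nonneg_left
      (Real.log_le_log h (Finset.single_le_sum hq hi)) h.le

lemma entropy_map_le (P : PMF α) (f : α → β) (φ : β → γ) :
    entropy P (fun a => φ (f a)) ≤ entropy P f := by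
  classical
  have hmap : P.map (fun a => φ (f a)) = (P.map f).map φ := by
    rw [PMF.map_comp]; rfl
  unfold entropy
  rw [← Finset.sum_div, ← Finset.sum_div, hmap]
  refine div_le_div_of_nonneg_right ?_ (Real.log_nonneg one_le_two)
  calc ∑ c, Real.negMulLog ((P.map f).map φ c).toReal
      ≤ ∑ c, ∑ b with φ b = c, Real.negMulLog (P.map f b).toReal := by
        refine Finset.sum_le_sum fun c _ => ?_
        rw [toReal_map_apply]
        simp_rw [eq_comm (a := c)]
        rw [← Finset.sum_filter]
        exact negMulLog_sum_le _ _ fun b _ => ENNReal.toReal_nonneg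
    _ = ∑ b, Real.negMulLog (P.map f b).toReal := Finset.sum_fiberwise _ _ _

/-- A random variable that is determined by another one has at most its entropy. -/
lemma entropy_le_of_determines (P : PMF α) (f : α → β) (g : α → γ)
    (h : ∀ a a', f a = f a' → g a = g a') : entropy P g ≤ entropy P f := by
  obtain ⟨a₀, -⟩ := P.support_nonempty
  have : Nonempty γ := ⟨g a₀⟩
  obtain ⟨φ, hφ⟩ := (Function.factorsThrough_iff (f := f) g).1 fun a a' haa => h a a' haa
  rw [hφ]
  exact entropy_map_le P f φ

lemma sum_toReal_map_prod (P : PMF α) (q : α → γ) (h : α → δ) (d : δ) :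
    ∑ c, (P.map (fun a => (q a, h a)) (c, d)).toReal = (P.map h d).toReal := by
  classical
  have hmap : P.map h = (P.map fun a => (q a, h a)).map Prod.snd := by
    rw [PMF.map_comp]; rfl
  rw [hmap, toReal_map_apply, Fintype.sum_prod_type]
  simp

/-- Jensen with equal weights. The masses `p` are not normalised, so that the bound applies to each
slice of a joint law. -/
lemma sum_negMulLog_le [Nonempty γ] (p : γ → ℝ) (hp : ∀ c, 0 ≤ p c) :
    ∑ c, Real.negMulLog (p c) ≤
      Real.negMulLog (∑ c, p c) + (∑ c, p c) * Real.log (Fintype.card γ) := by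
  have hn : (0 : ℝ) < Fintype.card γ := by exact_mod_cast Fintype.card_pos
  have hJ := Real.concaveOn_negMulLog.le_map_sum (t := Finset.univ)
    (w := fun _ : γ => (Fintype.card γ : ℝ)⁻¹) (p := p) (fun _ _ => (inv_pos.2 hn).le)
    (by simp [hn.ne']) (fun c _ => hp c)
  simp only [smul_eq_mul, ← Finset.mul_sum] at hJ
  rw [Real.negMulLog_mul] at hJ
  have h2 : Real.negMulLog (Fintype.card γ : ℝ)⁻¹
      = (Fintype.card γ : ℝ)⁻¹ * Real.log (Fintype.card γ) := by
    rw [Real.negMulLog, Real.log_inv]; ring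
  rw [h2] at hJ
  refine le_of_mul_le_mul_left (hJ.trans_eq ?_) (inv_pos.2 hn)
  ring

lemma entropy_prod_eq_sum (P : PMF α) (q : α → γ) (h : α → δ) :
    entropy P (fun a => (q a, h a)) =
      (∑ d, ∑ c, Real.negMulLog (P.map (fun a => (q a, h a)) (c, d)).toReal) / Real.log 2 := by
  rw [entropy, ← Finset.sum_div, Fintype.sum_prod_type, Finset.sum_comm]

lemma entropy_add_log_card (P : PMF α) (h : α → δ) :
    entropy P h + Real.log (Fintype.card γ) / Real.log 2 =
      (∑ d, (Real.negMulLog (P.map h d).toReal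
        + (P.map h d).toReal * Real.log (Fintype.card γ))) / Real.log 2 := by
  rw [entropy, ← Finset.sum_div, Finset.sum_add_distrib, ← Finset.sum_mul, sum_toReal_eq_one,
    one_mul, add_div]

lemma entropy_prod_le (P : PMF α) (q : α → γ) (h : α → δ) :
    entropy P (fun a => (q a, h a)) ≤
      entropy P h + Real.log (Fintype.card γ) / Real.log 2 := by
  obtain ⟨a₀, -⟩ := P.support_nonempty
  have : Nonempty γ := ⟨q a₀⟩
  rw [entropy_prod_eq_sum, entropy_add_log_card]
  refine div_le_div_of_nonneg_right (Finset.sum_le_sum fun d _ => ?_)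
    (Real.log_nonneg one_le_two)
  rw [← sum_toReal_map_prod P q h d]
  exact sum_negMulLog_le _ fun c => ENNReal.toReal_nonneg

/-- If the law is invariant under permutations that fix `h` and translate `q` arbitrarily, then
`q` is uniform given `h`. -/
lemma entropy_prod_eq_of_translations [AddGroup γ] (P : PMF α) (q : α → γ) (h : α → δ)
    (T : γ → α → α) (hP : ∀ c, P.map (T c) = P) (hq : ∀ c a, q (T c a) = q a + c)
    (hh : ∀ c a, h (T c a) = h a) :
    entropy P (fun a => (q a, h a)) =
      entropy P h + Real.log (Fintype.card γ) / Real.log 2 := by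
  classical
  have hn : (0 : ℝ) < Fintype.card γ := by exact_mod_cast Fintype.card_pos
  -- The joint law of `(q, h)` is invariant under translating its first coordinate, and `(0, d)` is
  -- the only point that translation by `c` sends to `(c, d)`.
  have hconst : ∀ c d, (P.map (fun a => (q a, h a)) (c, d)).toReal
      = (P.map (fun a => (q a, h a)) (0, d)).toReal := by
    intro c d
    have h1 : P.map (fun a => (q a, h a))
        = (P.map (fun a => (q a, h a))).map (fun z => (z.1 + c, z.2)) := by
      conv_lhs => rw [← hP c]
      rw [PMF.map_comp, PMF.map_comp]
      congr 1
      funext a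
      simp [hq, hh]
    conv_lhs => rw [h1]
    rw [toReal_map_apply, Finset.sum_eq_single (0, d)]
    · simp
    · rintro ⟨c', d'⟩ - hne
      rw [if_neg]
      rintro heq
      simp only [Prod.mk.injEq] at heq
      apply hne
      rw [heq.2, right_eq_add.1 heq.1]
    · simp
  rw [entropy_prod_eq_sum, entropy_add_log_card]
  congr 1
  refine Finset.sum_congr rfl fun d _ => ?_
  rw [← sum_toReal_map_prod P q h d]
  simp_rw [hconst]
  simp only [Finset.sum_const, Finset.card_univ, nsmul_eq_mul]
  rw [Real.negMulLog_mul]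
  simp only [Real.negMulLog]
  ring

/-- As `f` is a function of `(g, h)`, the term `H(f | g, h)` vanishes. -/
lemma condMutualInfo_eq_of_determines (P : PMF α) (f : α → β) (g : α → γ) (h : α → δ)
    (hf : ∀ a a', g a = g a' → h a = h a' → f a = f a') :
    condMutualInfo P f g h = entropy P (fun a => (f a, h a)) - entropy P h := by
  have h1 : entropy P (fun a => (f a, g a, h a)) = entropy P (fun a => (g a, h a)) := by
    refine le_antisymm (entropy_le_of_determines _ _ _ ?_) (entropy_le_of_determines _ _ _ ?_)
    · intro a a' haa
      simp only [Prod.mk.injEq] at haa ⊢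
      exact ⟨hf a a' haa.1 haa.2, haa⟩
    · intro a a' haa
      simp only [Prod.mk.injEq] at haa ⊢
      exact haa.2
  rw [condMutualInfo, h1]
  ring

end Entropy

/-! ### The channel as a linear map -/

section Channel

variable {K : ℕ} {n : Fin K → Fin K → ℕ}

lemma output_add (l : Fin K) (x y : Fin K → Sig n) :
    output n l (x + y) = output n l x + output n l y := by
  simp [output, Matrix.mulVec_add, Finset.sum_add_distrib]

/-- The levels `s j` carry exactly the information in `Y_j` that is not contained in the inputs and
outputs with smaller index. -/
structure IsInnovation (n : Fin K → Fin K → ℕ) (s : Fin K → Finset (Fin (levels n))) : Prop where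
  determines : ∀ (j : Fin K) (x x' : Fin K → Sig n), (∀ i < j, x i = x' i) →
    (∀ i < j, output n i x = output n i x') →
    (∀ a ∈ s j, output n j x a = output n j x' a) → output n j x = output n j x'
  realizes : ∀ (j : Fin K) (c : Sig n), ∃ v : Fin K → Sig n, (∀ i < j, v i = 0) ∧
    (∀ i < j, output n i v = 0) ∧ ∀ a ∈ s j, output n j v a = c a

lemma log_card_fun_zmod_two (ι : Type) [Fintype ι] [DecidableEq ι] :
    Real.log (Fintype.card (ι → ZMod 2)) / Real.log 2 = Fintype.card ι := by
  rw [Fintype.card_fun, ZMod.card, Nat.cast_pow, Real.log_pow]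
  have : Real.log 2 ≠ 0 := (Real.log_pos one_lt_two).ne'
  push_cast
  field_simp

lemma eq_of_tail_eq_of_head_eq {j : Fin K} {x x' : Fin K → Sig n}
    (hg : (fun i : {i : Fin K // j ≤ i} => x i.1) = fun i => x' i.1)
    (hh : (fun i : {i : Fin K // i < j} => x i.1) = fun i => x' i.1) : x = x' := by
  funext i
  rcases le_or_gt j i with h | h
  · exact congrFun hg ⟨i, h⟩
  · exact congrFun hh ⟨i, h⟩

/-- The `j`-th term of the sum-rate bound, with `Y_j` replaced by its innovation levels. -/
lemma condMutualInfo_eq_innovation {s : Fin K → Finset (Fin (levels n))} (hs : IsInnovation n s)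
    (P : PMF (Fin K → Sig n)) (j : Fin K) :
    condMutualInfo P
      (fun x => output n j x)
      (fun x => fun i : {i : Fin K // j ≤ i} => x i.1)
      (fun x => ((fun i : {i : Fin K // i < j} => x i.1),
        (fun i : {i : Fin K // i < j} => output n i.1 x))) =
    entropy P (fun x => ((fun a : {a // a ∈ s j} => output n j x a.1),
      ((fun i : {i : Fin K // i < j} => x i.1),
        (fun i : {i : Fin K // i < j} => output n i.1 x)))) -
    entropy P (fun x => ((fun i : {i : Fin K // i < j} => x i.1),
      (fun i : {i : Fin K // i < j} => output n i.1 x))) := by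
  rw [condMutualInfo_eq_of_determines]
  · congr 1
    refine le_antisymm (entropy_le_of_determines _ _ _ ?_) (entropy_le_of_determines _ _ _ ?_)
    · intro x x' h
      simp only [Prod.mk.injEq] at h ⊢
      exact ⟨hs.determines j x x' (fun i hi => congrFun h.2.1 ⟨i, hi⟩)
        (fun i hi => congrFun h.2.2 ⟨i, hi⟩) (fun a ha => congrFun h.1 ⟨a, ha⟩), h.2⟩
    · intro x x' h
      simp only [Prod.mk.injEq] at h ⊢
      exact ⟨by rw [h.1], h.2⟩
  · intro x x' hg hh
    simp only [Prod.mk.injEq] at hh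
    rw [eq_of_tail_eq_of_head_eq hg hh.1]

lemma sumRateBound_le {s : Fin K → Finset (Fin (levels n))} (hs : IsInnovation n s)
    (P : PMF (Fin K → Sig n)) : sumRateBound n P ≤ ∑ j, ((s j).card : ℝ) := by
  refine Finset.sum_le_sum fun j _ => ?_
  rw [condMutualInfo_eq_innovation hs P j, sub_le_iff_le_add']
  refine (entropy_prod_le _ _ _).trans_eq ?_
  rw [log_card_fun_zmod_two, Fintype.card_coe]

lemma map_uniform_add_right {V : Type} [Fintype V] [AddGroup V] (v : V) :
    (PMF.uniformOfFintype V).map (fun x => x + v) = PMF.uniformOfFintype V := by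
  classical
  ext y
  rw [PMF.map_apply, tsum_eq_single (y - v)]
  · simp
  · intro x hx
    rw [if_neg]
    rintro rfl
    simp at hx

/-- Adding the vectors from `realizes` preserves the uniform law and the conditioning variables but
translates the innovation levels arbitrarily, so these levels are conditionally uniform. -/
lemma sumRateBound_uniform {s : Fin K → Finset (Fin (levels n))} (hs : IsInnovation n s) :
    sumRateBound n (PMF.uniformOfFintype (Fin K → Sig n)) = ∑ j, ((s j).card : ℝ) := by
  classical
  refine Finset.sum_congr rfl fun j _ => ?_
  rw [condMutualInfo_eq_innovation hs _ j, sub_eq_iff_eq_add']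
  have hv : ∀ c : {a // a ∈ s j} → ZMod 2, ∃ v : Fin K → Sig n, (∀ i < j, v i = 0) ∧
      (∀ i < j, output n i v = 0) ∧ ∀ a : {a // a ∈ s j}, output n j v a.1 = c a := by
    intro c
    obtain ⟨v, h1, h2, h3⟩ := hs.realizes j fun a => if h : a ∈ s j then c ⟨a, h⟩ else 0
    exact ⟨v, h1, h2, fun a => by rw [h3 a.1 a.2, dif_pos a.2]⟩
  choose v hv0 hv1 hv2 using hv
  rw [entropy_prod_eq_of_translations (T := fun c x => x + v c)]
  · rw [log_card_fun_zmod_two, Fintype.card_coe]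
  · exact fun c => map_uniform_add_right (v c)
  · intro c x
    funext a
    simp [output_add, hv2]
  · intro c x
    refine Prod.ext (funext fun i => ?_) (funext fun i => ?_)
    · simp [hv0 c i.1 i.2]
    · simp [output_add, hv1 c i.1 i.2]

theorem IsInnovation.isSumRateOuterBound {s : Fin K → Finset (Fin (levels n))}
    (hs : IsInnovation n s) : IsSumRateOuterBound n (∑ j, ((s j).card : ℝ)) :=
  ⟨⟨_, sumRateBound_uniform hs⟩, by rintro _ ⟨P, rfl⟩; exact sumRateBound_le hs P⟩

/-! ### The counting converse for cumulative message sharing -/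

namespace Code

variable {A : Fin K → Finset (Fin K)} {M : Fin K → Type} {N : ℕ}

lemma errorAt_le_errorProb (c : Code n A M N) (l : Fin K) : c.errorAt l ≤ c.errorProb :=
  le_ciSup (f := fun l => c.errorAt l) (Set.finite_range _).bddAbove l

lemma errorProb_eq_zero (c : Code n A M N) (h : ∀ w l, c.dec l (c.received w l) = w l) :
    c.errorProb = 0 := by
  have : ∀ l, c.errorAt l = 0 := by
    intro l
    have : IsEmpty {w : ∀ j, M j // c.dec l (c.received w l) ≠ w l} := ⟨fun w => w.2 (h w.1 l)⟩
    simp [errorAt]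
  simp [errorProb, this]

/-- Correctly decoded messages are determined by the innovation levels of the received blocks. -/
lemma eq_of_innovation_eq {s : Fin K → Finset (Fin (levels n))} (hs : IsInnovation n s)
    (c : Code n (cms K) M N) {w w' : ∀ j, M j} (hw : ∀ l, c.dec l (c.received w l) = w l)
    (hw' : ∀ l, c.dec l (c.received w' l) = w' l)
    (h : ∀ j t, ∀ a ∈ s j, c.received w j t a = c.received w' j t a) : w = w' := by
  have key : ∀ j, w j = w' j ∧ c.received w j = c.received w' j := by
    intro j
    induction j using WellFoundedLT.induction with
    | ind j ih =>
      have hrec : c.received w j = c.received w' j := by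
        funext t
        refine hs.determines j _ _ (fun i hi => ?_) (fun i hi => congrFun (ih i hi).2 t) (h j t)
        have : (fun k : {k // k ∈ cms K i} => w k.1) = fun k : {k // k ∈ cms K i} => w' k.1 :=
          funext fun k => (ih k.1 (((Finset.mem_filter.1 k.2).2).trans_lt hi)).1
        simp only [this]
      exact ⟨by rw [← hw j, ← hw' j, hrec], hrec⟩
  exact funext fun j => (key j).1

lemma card_correct_le {s : Fin K → Finset (Fin (levels n))} (hs : IsInnovation n s)
    (c : Code n (cms K) M N) :
    Nat.card {w : ∀ j, M j // ∀ l, c.dec l (c.received w l) = w l} ≤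
      2 ^ (N * ∑ j, (s j).card) := by
  let F : {w : ∀ j, M j // ∀ l, c.dec l (c.received w l) = w l} →
      (Fin N × (Σ j, {a // a ∈ s j}) → ZMod 2) :=
    fun w p => c.received w.1 p.2.1 p.1 p.2.2.1
  have hF : Function.Injective F := fun w w' hww =>
    Subtype.ext (eq_of_innovation_eq hs c w.2 w'.2 fun j t a ha => congrFun hww (t, ⟨j, a, ha⟩))
  refine (Nat.card_le_card_of_injective F hF).trans_eq ?_
  simp [Nat.card_eq_fintype_card]

/-- Union bound over the receivers. -/
lemma card_le_card_correct_add [∀ j, Finite (M j)] (c : Code n A M N) :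
    Nat.card (∀ j, M j) ≤ Nat.card {w : ∀ j, M j // ∀ l, c.dec l (c.received w l) = w l} +
      ∑ l, Nat.card {w : ∀ j, M j // c.dec l (c.received w l) ≠ w l} := by
  classical
  have := fun j => Fintype.ofFinite (M j)
  simp only [Nat.card_eq_fintype_card, Fintype.card_subtype]
  rw [← Finset.card_univ]
  refine le_trans (Finset.card_le_card (t := Finset.univ.filter (fun w : ∀ j, M j =>
    ∀ l, c.dec l (c.received w l) = w l) ∪ Finset.univ.biUnion fun l : Fin K =>
    Finset.univ.filter fun w : ∀ j, M j => c.dec l (c.received w l) ≠ w l) ?_)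
    ((Finset.card_union_le _ _).trans (Nat.add_le_add_left Finset.card_biUnion_le _))
  intro w _
  by_cases hw : ∀ l, c.dec l (c.received w l) = w l
  · simp [hw]
  · push Not at hw
    exact Finset.mem_union_right _ (by simpa using hw)

lemma card_mul_le [∀ j, Finite (M j)] [∀ j, Nonempty (M j)]
    {s : Fin K → Finset (Fin (levels n))} (hs : IsInnovation n s)
    (c : Code n (cms K) M N) :
    (Nat.card (∀ j, M j) : ℝ) * (1 - K * c.errorProb) ≤ 2 ^ (N * ∑ j, (s j).card) := by
  have hpos : (0 : ℝ) < Nat.card (∀ j, M j) := by exact_mod_cast Nat.card_pos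
  have h1 : (Nat.card (∀ j, M j) : ℝ) ≤ 2 ^ (N * ∑ j, (s j).card) +
      ∑ l, (Nat.card {w : ∀ j, M j // c.dec l (c.received w l) ≠ w l} : ℝ) := by
    exact_mod_cast (card_le_card_correct_add c).trans
      (Nat.add_le_add_right (card_correct_le hs c) _)
  have h2 : ∑ l, (Nat.card {w : ∀ j, M j // c.dec l (c.received w l) ≠ w l} : ℝ) ≤
      ∑ _l : Fin K, (Nat.card (∀ j, M j) : ℝ) * c.errorProb := by
    refine Finset.sum_le_sum fun l _ => ?_
    rw [← div_le_iff₀' hpos]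
    exact c.errorAt_le_errorProb l
  simp only [Finset.sum_const, Finset.card_univ, Fintype.card_fin, nsmul_eq_mul] at h2
  linarith

end Code

/-- An excess rate `δ > 0` would force `2 ^ (N δ) * (1 - K * errorProb) ≤ 1` for all large `N`,
while the left side tends to infinity. -/
theorem IsInnovation.sum_rate_le {s : Fin K → Finset (Fin (levels n))} (hs : IsInnovation n s)
    {R : Fin K → ℝ} (hR : R ∈ capacityRegion n (cms K)) :
    ∑ i, R i ≤ ∑ j, ((s j).card : ℝ) := by
  obtain ⟨-, c, hc⟩ := hR
  by_contra! hlt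
  set δ := ∑ i, R i - ∑ j, ((s j).card : ℝ) with hδ
  have hδ0 : 0 < δ := sub_pos.2 hlt
  have hlim : Filter.Tendsto (fun N => 1 - K * (c N).errorProb) Filter.atTop (nhds 1) := by
    simpa using (hc.const_mul (K : ℝ)).const_sub 1
  have hhalf := hlim.eventually (lt_mem_nhds (show (1 / 2 : ℝ) < 1 by norm_num))
  have hgrow : Filter.Tendsto (fun N : ℕ => (2 : ℝ) ^ ((N : ℝ) * δ)) Filter.atTop Filter.atTop := by
    simp_rw [mul_comm _ δ, Real.rpow_mul_natCast (zero_le_two : (0 : ℝ) ≤ 2)]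
    exact tendsto_pow_atTop_atTop_of_one_lt (Real.one_lt_rpow one_lt_two hδ0)
  obtain ⟨N, hN1, hN2⟩ := (hhalf.and (hgrow.eventually_gt_atTop 2)).exists
  have : ∀ i, Nonempty (Fin ⌈(2 : ℝ) ^ ((N : ℝ) * R i)⌉₊) := fun i =>
    ⟨⟨0, Nat.ceil_pos.2 (Real.rpow_pos_of_pos two_pos _)⟩⟩
  have hcard : (2 : ℝ) ^ ((N : ℝ) * ∑ i, R i) ≤
      Nat.card (∀ i, Fin ⌈(2 : ℝ) ^ ((N : ℝ) * R i)⌉₊) := by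
    rw [Nat.card_pi, Finset.mul_sum, Real.rpow_sum_of_pos two_pos]
    push_cast
    refine Finset.prod_le_prod (fun i _ => (Real.rpow_pos_of_pos two_pos _).le) fun i _ => ?_
    rw [Nat.card_eq_fintype_card, Fintype.card_fin]
    exact Nat.le_ceil _
  have hle := (mul_le_mul_of_nonneg_right hcard (by linarith)).trans ((c N).card_mul_le hs)
  have hpow : (2 : ℝ) ^ (N * ∑ j, (s j).card) =
      (2 : ℝ) ^ ((N : ℝ) * ∑ j, ((s j).card : ℝ)) := by
    rw [← Real.rpow_natCast]; push_cast; rfl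
  have hsum : ∑ i, R i = δ + ∑ j, ((s j).card : ℝ) := by rw [hδ]; ring
  have hpos : (0 : ℝ) < 2 ^ ((N : ℝ) * ∑ j, ((s j).card : ℝ)) := Real.rpow_pos_of_pos two_pos _
  rw [hpow, hsum, mul_add, Real.rpow_add two_pos, mul_right_comm] at hle
  have := le_of_mul_le_mul_right (hle.trans_eq (one_mul _).symm) hpos
  nlinarith

end Channel

/-! ### Achievability by linear codes without error -/

section Achievability

variable {K : ℕ} {n : Fin K → Fin K → ℕ} {A B : Fin K → Finset (Fin K)}

/-- More message knowledge at the transmitters enlarges the capacity region. -/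
lemma capacityRegion_mono (h : ∀ i, A i ⊆ B i) : capacityRegion n A ⊆ capacityRegion n B := by
  rintro R ⟨hR, c, hc⟩
  exact ⟨hR, fun N => ⟨fun i w => (c N).enc i fun j => w ⟨j.1, h i j.2⟩, (c N).dec⟩, hc⟩

lemma lastOnly_subset_cms (i : Fin K) : lastOnly K i ⊆ cms K i := by
  intro j hj
  rw [cms, Finset.mem_filter]
  refine ⟨Finset.mem_univ _, ?_⟩
  rw [lastOnly] at hj
  split_ifs at hj with h
  · rw [Fin.le_def]; omega
  · exact (Finset.mem_singleton.1 hj).le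

lemma mem_lastOnly_self (i : Fin K) : i ∈ lastOnly K i := by
  rw [lastOnly]; split_ifs <;> simp

/-- For integer rates the ceiling is vacuous, so the binary messages only need relabelling. -/
lemma mem_capacityRegion_of_perfect_codes (k : Fin K → ℕ)
    (h : ∀ N, ∃ c : Code n A (fun i => Fin (N * k i) → ZMod 2) N,
      ∀ w l, c.dec l (c.received w l) = w l) :
    (fun i => (k i : ℝ)) ∈ capacityRegion n A := by
  choose c hc using h
  have hcard : ∀ (N : ℕ) (i : Fin K), ⌈(2 : ℝ) ^ ((N : ℝ) * (k i : ℝ))⌉₊ =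
      Fintype.card (Fin (N * k i) → ZMod 2) := by
    intro N i
    have : (2 : ℝ) ^ ((N : ℝ) * (k i : ℝ)) = ((2 ^ (N * k i) : ℕ) : ℝ) := by
      rw [← Nat.cast_mul, Real.rpow_natCast]; push_cast; rfl
    rw [this, Nat.ceil_natCast]
    simp
  let e : ∀ (N : ℕ) (i : Fin K),
      Fin ⌈(2 : ℝ) ^ ((N : ℝ) * (k i : ℝ))⌉₊ ≃ (Fin (N * k i) → ZMod 2) :=
    fun N i => (finCongr (hcard N i)).trans (Fintype.equivFin _).symm
  refine ⟨fun i => Nat.cast_nonneg _, fun N => ⟨fun i w => (c N).enc i fun j => e N j.1 (w j),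
    fun l y => (e N l).symm ((c N).dec l y)⟩, ?_⟩
  refine tendsto_const_nhds.congr fun N => ?_
  rw [Code.errorProb_eq_zero]
  intro w l
  exact (e N l).symm_apply_eq.2 (hc N (fun j => e N j (w j)) l)

/-- Repeating a linear scheme for a single channel use gives linear codes of every block length. -/
lemma exists_linear_codes {ι : Fin K → Type} [∀ j, Fintype (ι j)]
    (F : ∀ _ : Fin K, (∀ j, ι j → ZMod 2) →ₗ[ZMod 2] Sig n)
    (G : ∀ l : Fin K, Sig n →ₗ[ZMod 2] (ι l → ZMod 2))
    (hF : ∀ i w w', (∀ j ∈ A i, w j = w' j) → F i w = F i w')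
    (hG : ∀ w l, G l (output n l fun i => F i w) = w l) (N : ℕ) :
    ∃ c : Code n A (fun i => Fin (N * Fintype.card (ι i)) → ZMod 2) N,
      c.IsLinear ∧ ∀ w l, c.dec l (c.received w l) = w l := by
  classical
  let e : ∀ j, Fin (N * Fintype.card (ι j)) ≃ Fin N × ι j := fun j =>
    finProdFinEquiv.symm.trans ((Equiv.refl _).prodCongr (Fintype.equivFin _).symm)
  -- Messages unknown to transmitter `i` are replaced by `0`; by `hF` this does not affect its
  -- signal.
  refine ⟨⟨fun i u t => F i fun j => if h : j ∈ A i then fun a => u ⟨j, h⟩ ((e j).symm (t, a))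
    else 0, fun l y p => G l (y (e l p).1) (e l p).2⟩, ⟨fun i => ⟨?_, ?_⟩, fun l => ⟨?_, ?_⟩⟩, ?_⟩
  · intro u u'
    funext t
    rw [Pi.add_apply, ← map_add]
    refine congrArg (F i) (funext fun j => ?_)
    by_cases h : j ∈ A i
    · simp only [h, dif_pos, Pi.add_apply]; rfl
    · simp [h]
  · intro r u
    funext t
    rw [Pi.smul_apply, ← map_smul]
    refine congrArg (F i) (funext fun j => ?_)
    by_cases h : j ∈ A i
    · simp only [h, dif_pos, Pi.smul_apply]; rfl
    · simp [h]
  · intro y y'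
    funext p
    simp
  · intro r y
    funext p
    simp
  · intro w l
    funext p
    have hX : ∀ i, (F i fun j => if _h : j ∈ A i then fun a => w j ((e j).symm ((e l p).1, a))
        else 0) = F i fun j a => w j ((e j).symm ((e l p).1, a)) :=
      fun i => hF i _ _ fun j hj => by rw [dif_pos hj]
    have := congrFun (hG (fun j a => w j ((e j).symm ((e l p).1, a))) l) (e l p).2
    simp only [Code.received]
    simp only [hX]
    rw [this]
    simp

end Achievability

/-! ### Shifts -/

section Shift

variable {m : ℕ}

lemma shift_pow_mulVec_apply (k : ℕ) (x : Fin m → ZMod 2) (a : Fin m) :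
    (shift m ^ k).mulVec x a =
      if k ≤ (a : ℕ) then x ⟨a - k, (Nat.sub_le _ _).trans_lt a.2⟩ else 0 := by
  induction k generalizing a with
  | zero => simp
  | succ k ih =>
    rw [pow_succ', ← Matrix.mulVec_mulVec, Matrix.mulVec, dotProduct]
    by_cases ha : 1 ≤ (a : ℕ)
    · rw [Finset.sum_eq_single ⟨a - 1, (Nat.sub_le _ _).trans_lt a.2⟩]
      · rw [ih]
        have h1 : (a : ℕ) = a - 1 + 1 := by omega
        have h2 : k ≤ (a : ℕ) - 1 ↔ k + 1 ≤ a := by omega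
        simp only [shift, Matrix.of_apply, if_pos h1, one_mul, h2]
        congr 2
        exact Fin.ext (by simp only; omega)
      · intro b _ hb
        have : (a : ℕ) ≠ b + 1 := fun h => hb (Fin.ext (by simp only; omega))
        simp [shift, this]
      · simp
    · rw [if_neg (by omega)]
      refine Finset.sum_eq_zero fun b _ => ?_
      have : (a : ℕ) ≠ b + 1 := by omega
      simp [shift, this]

/-- The linear map `S ^ (m - g)` of a link with gain `g`. -/
def link (m g : ℕ) : (Fin m → ZMod 2) →ₗ[ZMod 2] (Fin m → ZMod 2) :=
  (shift m ^ (m - g)).mulVecLin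

lemma link_apply (g : ℕ) (x : Fin m → ZMod 2) (a : Fin m) :
    link m g x a =
      if m - g ≤ (a : ℕ) then x ⟨a - (m - g), (Nat.sub_le _ _).trans_lt a.2⟩ else 0 := by
  rw [link, Matrix.mulVecLin_apply, shift_pow_mulVec_apply]

lemma link_self (x : Fin m → ZMod 2) : link m m x = x := by
  simp [link]

/-- A link with gain `g` erases exactly the levels from `g` on. -/
lemma link_eq_iff {g : ℕ} (hg : g ≤ m) (x y : Fin m → ZMod 2) :
    link m g x = link m g y ↔ ∀ a : Fin m, (a : ℕ) < g → x a = y a := by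
  constructor
  · intro h a ha
    have := congrFun h ⟨a + (m - g), by omega⟩
    simpa [link_apply] using this
  · intro h
    funext a
    rw [link_apply, link_apply]
    split_ifs
    · exact h _ (by simp only; omega)
    · rfl

/-- A positive power of the shift is nilpotent: each entry of a fixed vector is zero or equals an
earlier entry. -/
lemma eq_zero_of_shift_pow_fixed {k : ℕ} (hk : 0 < k) {x : Fin m → ZMod 2}
    (h : (shift m ^ k).mulVec x = x) : x = 0 := by
  funext a
  induction a using WellFoundedLT.induction with
  | ind a ih =>
    rw [← h, shift_pow_mulVec_apply]
    split_ifs with hle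
    · exact ih _ (by rw [Fin.lt_def]; simp only; omega)
    · rfl

/-- The sum of a direct and an interfering link. -/
def linkSum (m nd ni : ℕ) : (Fin m → ZMod 2) →ₗ[ZMod 2] (Fin m → ZMod 2) :=
  link m nd + link m ni

/-- In characteristic two a kernel vector has equal images under both links. The stronger link is
the identity and the weaker one a proper shift, so the vector is fixed by that shift. -/
lemma linkSum_injective {nd ni : ℕ} (hm : m = max nd ni) (hne : nd ≠ ni) :
    Function.Injective (linkSum m nd ni) := by
  rw [injective_iff_map_eq_zero]
  intro x hx
  have hx' : link m nd x = link m ni x := by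
    rw [linkSum, LinearMap.add_apply] at hx
    exact funext fun a => CharTwo.add_eq_zero.1 (congrFun hx a)
  rcases lt_or_gt_of_ne hne with h | h
  · have hmi : m = ni := by omega
    rw [← hmi, link_self] at hx'
    exact eq_zero_of_shift_pow_fixed (k := m - nd) (by omega) hx'
  · have hmd : m = nd := by omega
    rw [← hmd, link_self] at hx'
    exact eq_zero_of_shift_pow_fixed (k := m - ni) (by omega) hx'.symm

lemma linkSum_surjective {nd ni : ℕ} (hm : m = max nd ni) (hne : nd ≠ ni) :
    Function.Surjective (linkSum m nd ni) :=
  LinearMap.injective_iff_surjective.1 (linkSum_injective hm hne)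

/-- Set the levels below `g` to zero. -/
def lowPart (m g : ℕ) : (Fin m → ZMod 2) →ₗ[ZMod 2] (Fin m → ZMod 2) where
  toFun x a := if (a : ℕ) < g then 0 else x a
  map_add' x y := by funext a; simp only [Pi.add_apply]; split_ifs <;> simp
  map_smul' r x := by funext a; simp only [Pi.smul_apply]; split_ifs <;> simp

lemma link_lowPart {g : ℕ} (hg : g ≤ m) (x : Fin m → ZMod 2) : link m g (lowPart m g x) = 0 := by
  rw [← map_zero (link m g), link_eq_iff hg]
  intro a ha
  simp [lowPart, ha]

/-- A level `a ≥ ni` exists only if `ni < m`, which forces `m = nd`; for `ni > nd` the claim is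
vacuous. -/
lemma link_direct_apply {nd ni : ℕ} (hm : m = max nd ni) (x : Fin m → ZMod 2) {a : Fin m}
    (ha : ni ≤ (a : ℕ)) : link m nd x a = x a := by
  have : m = nd := by have := a.2; omega
  rw [← this, link_self]

/-- Fill the levels outside of `s` with zeros. -/
def extendZero (s : Finset (Fin m)) : ({a // a ∈ s} → ZMod 2) →ₗ[ZMod 2] (Fin m → ZMod 2) where
  toFun x a := if h : a ∈ s then x ⟨a, h⟩ else 0
  map_add' x y := by funext a; simp only [Pi.add_apply]; split_ifs <;> simp
  map_smul' r x := by funext a; simp only [Pi.smul_apply]; split_ifs <;> simp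

/-- Keep the levels in `s`. -/
def keep (s : Finset (Fin m)) : (Fin m → ZMod 2) →ₗ[ZMod 2] ({a // a ∈ s} → ZMod 2) :=
  LinearMap.funLeft _ _ Subtype.val

lemma keep_apply (s : Finset (Fin m)) (x : Fin m → ZMod 2) (a : {a // a ∈ s}) :
    keep s x a = x a.1 := rfl

lemma extendZero_apply (s : Finset (Fin m)) (x : {a // a ∈ s} → ZMod 2) (a : {a // a ∈ s}) :
    extendZero s x a.1 = x a := by
  simp [extendZero]

lemma keep_extendZero (s : Finset (Fin m)) (x : {a // a ∈ s} → ZMod 2) :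
    keep s (extendZero s x) = x :=
  funext fun a => extendZero_apply s x a

end Shift

/-! ### The symmetric channel -/

section Symmetric

variable {K : ℕ} (nd ni : ℕ)

lemma levels_symGain (hK : 2 ≤ K) : levels (symGain K nd ni) = max nd ni := by
  refine le_antisymm (Finset.sup_le fun p _ => ?_) (max_le ?_ ?_)
  · rw [symGain]; split_ifs <;> simp
  · refine le_trans ?_ (Finset.le_sup
      (f := fun p : Fin K × Fin K => symGain K nd ni p.1 p.2)
      (Finset.mem_univ (⟨0, by omega⟩, ⟨0, by omega⟩)))
    simp [symGain]
  · refine le_trans ?_ (Finset.le_sup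
      (f := fun p : Fin K × Fin K => symGain K nd ni p.1 p.2)
      (Finset.mem_univ (⟨0, by omega⟩, ⟨1, by omega⟩)))
    simp [symGain]

variable {nd ni}

lemma add_self_eq_zero_fun {ι : Type} (x : ι → ZMod 2) : x + x = 0 :=
  funext fun a => CharTwo.add_self_eq_zero (x a)

/-- Adding `link ni (x l)` twice costs nothing in characteristic two and makes the interference term
common to all receivers. -/
lemma output_symGain (l : Fin K) (x : Fin K → Sig (symGain K nd ni)) :
    output (symGain K nd ni) l x =
      linkSum _ nd ni (x l) + link _ ni (∑ i, x i) := by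
  have h1 : output (symGain K nd ni) l x = link _ nd (x l) +
      ∑ i ∈ Finset.univ.erase l, link _ ni (x i) := by
    rw [output, ← Finset.add_sum_erase _ _ (Finset.mem_univ l)]
    congr 1
    · simp [symGain, link]
    · refine Finset.sum_congr rfl fun i hi => ?_
      simp [symGain, link, (Finset.ne_of_mem_erase hi).symm]
  rw [h1, map_sum, ← Finset.add_sum_erase _ (fun i => link _ ni (x i)) (Finset.mem_univ l),
    linkSum, LinearMap.add_apply, add_assoc, ← add_assoc (link _ ni (x l)) (link _ ni (x l)),
    add_self_eq_zero_fun, zero_add]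

/-- For different gains all levels are new, except that the last receiver only adds the levels at
which the interference does not reveal the last input. -/
def innovationOfNe (K nd ni : ℕ) (j : Fin K) : Finset (Fin (levels (symGain K nd ni))) :=
  if (j : ℕ) + 1 = K then Finset.univ.filter fun a => ni ≤ (a : ℕ) else Finset.univ

/-- For equal gains the first receiver sees everything. -/
def innovationOfEq (K nd ni : ℕ) (j : Fin K) : Finset (Fin (levels (symGain K nd ni))) :=
  if (j : ℕ) = 0 then Finset.univ else ∅

lemma output_single (l i : Fin K) (u : Sig (symGain K nd ni)) :
    output (symGain K nd ni) l (Pi.single i u) =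
      linkSum _ nd ni ((Pi.single i u : Fin K → Sig (symGain K nd ni)) l) + link _ ni u := by
  rw [output_symGain, Finset.sum_pi_single']
  simp

lemma isInnovation_of_ne (hK : 2 ≤ K) (hne : nd ≠ ni) :
    IsInnovation (symGain K nd ni) (innovationOfNe K nd ni) := by
  have hm := levels_symGain nd ni hK
  have hni : ni ≤ levels (symGain K nd ni) := hm ▸ le_max_right _ _
  constructor
  · intro j x x' hx hy hs
    by_cases hj : (j : ℕ) + 1 = K
    swap
    · funext a
      exact hs a (by simp [innovationOfNe, hj])
    have hne_j : ∀ i, i ≠ j → x i = x' i := fun i hi => hx i (by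
      rw [Fin.lt_def]; have := i.2; have := Fin.val_ne_of_ne hi; omega)
    have h0j : (⟨0, by omega⟩ : Fin K) < j := by rw [Fin.lt_def]; simp only; omega
    -- Only the last input is still unknown, and the first receiver sees it through an interfering
    -- link. This fixes its levels below `ni`; the levels from `ni` on are read off the last output.
    have hI : link _ ni (x j) = link _ ni (x' j) := by
      have h0 := hy _ h0j
      rw [output_symGain, output_symGain, hx _ h0j, add_right_inj,
        ← Finset.add_sum_erase _ _ (Finset.mem_univ j),
        ← Finset.add_sum_erase _ x' (Finset.mem_univ j),
        Finset.sum_congr rfl fun i hi => hne_j i (Finset.ne_of_mem_erase hi),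
        map_add, map_add, add_left_inj] at h0
      exact h0
    have hsum : link _ ni (∑ i, x i) = link _ ni (∑ i, x' i) := by
      rw [← Finset.add_sum_erase _ _ (Finset.mem_univ j),
        ← Finset.add_sum_erase _ x' (Finset.mem_univ j),
        Finset.sum_congr rfl fun i hi => hne_j i (Finset.ne_of_mem_erase hi),
        map_add, map_add, hI]
    have hxj : x j = x' j := by
      funext a
      rcases lt_or_ge (a : ℕ) ni with ha | ha
      · exact (link_eq_iff hni _ _).1 hI a ha
      · have h := hs a (by simp [innovationOfNe, hj, ha])
        rw [output_symGain, output_symGain, hsum, linkSum, LinearMap.add_apply,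
          LinearMap.add_apply, hI] at h
        simp only [Pi.add_apply, add_left_inj] at h
        rwa [link_direct_apply hm _ ha, link_direct_apply hm _ ha] at h
    rw [output_symGain, output_symGain, hsum, hxj]
  · intro j c
    by_cases hj : (j : ℕ) + 1 = K
    -- An input of the last user supported on the levels from `ni` on is invisible to every other
    -- receiver.
    · have hlow := link_lowPart hni c
      refine ⟨Pi.single j (lowPart _ ni c), fun i hi => Pi.single_eq_of_ne hi.ne _,
        fun i hi => ?_, fun a ha => ?_⟩
      · rw [output_single, Pi.single_eq_of_ne hi.ne, map_zero, zero_add, hlow]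
      · have ha' : ni ≤ (a : ℕ) := by simpa [innovationOfNe, hj] using ha
        rw [output_single, Pi.single_eq_same, linkSum, LinearMap.add_apply, hlow, add_zero,
          add_zero, link_direct_apply hm _ ha']
        simp [lowPart, ha']
    · obtain ⟨u, rfl⟩ := linkSum_surjective hm hne c
      let last : Fin K := ⟨K - 1, by omega⟩
      have hlast : ∀ i, i ≤ j → i ≠ last := by
        rintro i hi rfl
        have := j.2
        rw [Fin.le_def] at hi
        simp only [last] at hi
        omega
      -- Sending `u` from both `j` and the last user makes the sum of inputs zero, so receiver `j`
      -- sees `linkSum u` and earlier receivers see nothing.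
      refine ⟨Pi.single j u + Pi.single last u, fun i hi => ?_, fun i hi => ?_, fun a _ => ?_⟩
      · rw [Pi.add_apply, Pi.single_eq_of_ne hi.ne, Pi.single_eq_of_ne (hlast i hi.le), add_zero]
      · rw [output_add, output_single, output_single, Pi.single_eq_of_ne hi.ne,
          Pi.single_eq_of_ne (hlast i hi.le), map_zero, zero_add, add_self_eq_zero_fun]
      · rw [output_add, output_single, output_single, Pi.single_eq_same,
          Pi.single_eq_of_ne (hlast j le_rfl), map_zero, zero_add, add_assoc,
          add_self_eq_zero_fun, add_zero]

lemma output_symGain_self (hK : 2 ≤ K) (l : Fin K) (x : Fin K → Sig (symGain K nd nd)) :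
    output (symGain K nd nd) l x = ∑ i, x i := by
  have hm : levels (symGain K nd nd) = nd := by rw [levels_symGain nd nd hK, max_self]
  have hl : ∀ y, link (levels (symGain K nd nd)) nd y = y := by
    intro y
    conv_lhs => rw [show link (levels (symGain K nd nd)) nd
      = link (levels (symGain K nd nd)) (levels (symGain K nd nd)) by rw [hm]]
    exact link_self y
  rw [output_symGain, linkSum, LinearMap.add_apply, add_self_eq_zero_fun, zero_add, hl]

/-- All outputs coincide, so nothing is new after the first. -/
lemma isInnovation_of_eq (hK : 2 ≤ K) :
    IsInnovation (symGain K nd nd) (innovationOfEq K nd nd) := by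
  constructor
  · intro j x x' _ hy hs
    by_cases hj : (j : ℕ) = 0
    · funext a
      exact hs a (by simp [innovationOfEq, hj])
    · have h := hy ⟨0, by omega⟩ (by rw [Fin.lt_def]; simp only; omega)
      rw [output_symGain_self hK] at h ⊢
      rw [h, output_symGain_self hK, output_symGain_self hK]
  · intro j c
    by_cases hj : (j : ℕ) = 0
    · refine ⟨Pi.single j c, fun i hi => Pi.single_eq_of_ne hi.ne _, fun i hi => ?_, fun a _ => ?_⟩
      · rw [Fin.lt_def] at hi
        omega
      · rw [output_symGain_self hK, Finset.sum_pi_single']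
        simp
    · refine ⟨0, fun i _ => rfl, fun i _ => ?_, fun a ha => ?_⟩
      · rw [output_symGain_self hK]
        simp
      · simp [innovationOfEq, hj] at ha

/-! ### Codes for the symmetric channel -/

/-- The first user sends all its bits and the others are silent. -/
lemma exists_codes_of_eq (hK : 2 ≤ K) (N : ℕ) :
    ∃ c : Code (symGain K nd nd) (lastOnly K)
      (fun i => Fin (N * Fintype.card {a // a ∈ innovationOfEq K nd nd i}) → ZMod 2) N,
      c.IsLinear ∧ ∀ w l, c.dec l (c.received w l) = w l := by
  refine exists_linear_codes (fun i => extendZero _ ∘ₗ LinearMap.proj i) (fun l => keep _)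
    (fun i w w' h => ?_) (fun w l => ?_) N
  · simp [h i (mem_lastOnly_self i)]
  · funext a
    have hl : (l : ℕ) = 0 := by
      by_contra h
      simpa [innovationOfEq, h] using a.2
    rw [keep_apply, output_symGain_self hK, Finset.sum_apply, Finset.sum_eq_single l]
    · exact extendZero_apply _ _ a
    · intro i _ hi
      have : (i : ℕ) ≠ 0 := fun h => hi (Fin.ext (h.trans hl.symm))
      exact dif_neg (by simp [innovationOfEq, this])
    · simp

/-- The last transmitter turns the sum of all inputs into a signal that the interfering links
erase, and precodes its own message against the interference at its receiver. -/
lemma exists_codes_of_ne (hK : 2 ≤ K) (hne : nd ≠ ni) (N : ℕ) :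
    ∃ c : Code (symGain K nd ni) (lastOnly K)
      (fun i => Fin (N * Fintype.card {a // a ∈ innovationOfNe K nd ni i}) → ZMod 2) N,
      c.IsLinear ∧ ∀ w l, c.dec l (c.received w l) = w l := by
  have hm := levels_symGain nd ni hK
  have hni : ni ≤ levels (symGain K nd ni) := hm ▸ le_max_right _ _
  let s := innovationOfNe K nd ni
  let last : Fin K := ⟨K - 1, by omega⟩
  have hlast : ∀ i : Fin K, (i : ℕ) + 1 = K ↔ i = last := fun i =>
    ⟨fun h => Fin.ext (by simp only [last]; omega), fun h => by rw [h]; simp only [last]; omega⟩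
  let E := LinearEquiv.ofInjectiveEndo _ (linkSum_injective hm hne)
  have hE : ∀ x, E x = linkSum _ nd ni x := fun x => rfl
  let msg : ∀ j, (∀ j, {a // a ∈ s j} → ZMod 2) →ₗ[ZMod 2] Sig (symGain K nd ni) :=
    fun j => extendZero (s j) ∘ₗ LinearMap.proj j
  let T := ∑ j ∈ Finset.univ.erase last, msg j
  -- The last transmitter sends `T + U`. The summand `linkSum T` in `U` cancels, on the levels from
  -- `ni` on, what `T` contributes at the last receiver.
  let U := lowPart _ ni ∘ₗ (msg last + linkSum _ nd ni ∘ₗ T)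
  have hU : ∀ w, link _ ni (U w) = 0 := fun w => link_lowPart hni _
  let F : Fin K → (∀ j, {a // a ∈ s j} → ZMod 2) →ₗ[ZMod 2] Sig (symGain K nd ni) :=
    fun i => if i = last then T + U else msg i
  have hout : ∀ w l, output _ l (fun i => F i w) = linkSum _ nd ni (F l w) := by
    intro w l
    have hsum : ∑ i, F i w = U w := by
      rw [← Finset.add_sum_erase _ _ (Finset.mem_univ last),
        Finset.sum_congr rfl fun i hi => by
          rw [show F i = msg i from if_neg (Finset.ne_of_mem_erase hi)],
        show F last = T + U from if_pos rfl, ← LinearMap.sum_apply]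
      change T w + U w + T w = U w
      rw [add_right_comm, add_self_eq_zero_fun, zero_add]
    rw [output_symGain, hsum, hU, add_zero]
  refine exists_linear_codes F
    (fun l => keep (s l) ∘ₗ if l = last then LinearMap.id else E.symm.toLinearMap)
    (fun i w w' h => ?_) (fun w l => ?_) N
  · by_cases hi : i = last
    · have : w = w' := funext fun j => h j (by simp [lastOnly, (hlast i).2 hi])
      rw [this]
    · simp only [F, if_neg hi, msg, LinearMap.comp_apply, LinearMap.proj_apply,
        h i (mem_lastOnly_self i)]
  · rw [hout, LinearMap.comp_apply]
    by_cases hl : l = last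
    · subst hl
      funext a
      have ha : ni ≤ ((a.1 : Fin _) : ℕ) := by
        have := a.2
        simpa [s, innovationOfNe, (hlast last).2 rfl] using this
      have hUa : U w a.1 = w last a + linkSum _ nd ni (T w) a.1 := by
        have : U w a.1 = msg last w a.1 + linkSum _ nd ni (T w) a.1 := by
          simp [U, lowPart, ha]
        rw [this]
        congr 1
        exact extendZero_apply _ _ a
      rw [if_pos rfl, LinearMap.id_apply, keep_apply, show F last = T + U from if_pos rfl,
        LinearMap.add_apply, map_add, Pi.add_apply]
      -- The interfering link erases `U`, and the direct link acts as the identity at this level.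
      have hEU : linkSum _ nd ni (U w) a.1 = U w a.1 := by
        rw [linkSum, LinearMap.add_apply, hU, add_zero, link_direct_apply hm _ ha]
      rw [hEU, hUa, add_left_comm, CharTwo.add_self_eq_zero, add_zero]
    · rw [if_neg hl, show F l = msg l from if_neg hl, ← hE, LinearEquiv.coe_coe,
        LinearEquiv.symm_apply_apply]
      exact keep_extendZero _ _

/-! ### The value of the sum-capacity -/

lemma sum_card_innovationOfEq (hK : 2 ≤ K) :
    ∑ j, ((innovationOfEq K nd nd j).card : ℝ) = nd := by
  have hm : levels (symGain K nd nd) = nd := by rw [levels_symGain nd nd hK, max_self]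
  rw [Finset.sum_eq_single ⟨0, by omega⟩]
  · simp [innovationOfEq, hm]
  · intro j _ hj
    have : (j : ℕ) ≠ 0 := fun h => hj (Fin.ext h)
    simp [innovationOfEq, this]
  · simp

lemma card_filter_le_val (m g : ℕ) (hg : g ≤ m) :
    ((Finset.univ.filter fun a : Fin m => g ≤ (a : ℕ)).card : ℝ) = m - g := by
  have h1 : (Finset.univ.filter fun a : Fin m => (a : ℕ) < g).card = g := by
    rw [Fin.card_filter_val_lt, min_eq_right hg]
  have h2 := Finset.card_filter_add_card_filter_not (s := (Finset.univ : Finset (Fin m)))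
    (fun a => (a : ℕ) < g)
  rw [h1, Finset.card_univ, Fintype.card_fin] at h2
  simp only [not_lt] at h2
  rw [eq_sub_iff_add_eq, add_comm]
  exact_mod_cast h2

lemma sum_card_innovationOfNe (hK : 2 ≤ K) :
    ∑ j, ((innovationOfNe K nd ni j).card : ℝ) = K * max (nd : ℝ) (ni : ℝ) - ni := by
  have hm := levels_symGain nd ni hK
  have hni : ni ≤ levels (symGain K nd ni) := hm ▸ le_max_right _ _
  obtain ⟨L, rfl⟩ : ∃ L, K = L + 1 := ⟨K - 1, by omega⟩
  rw [Fin.sum_univ_castSucc]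
  have h1 : ∀ j : Fin L, ((innovationOfNe (L + 1) nd ni j.castSucc).card : ℝ)
      = max (nd : ℝ) (ni : ℝ) := by
    intro j
    have : ¬ (((j.castSucc : Fin (L + 1)) : ℕ) + 1 = L + 1) := by
      have := j.2
      simp only [Fin.val_castSucc]
      omega
    rw [innovationOfNe, if_neg this, Finset.card_univ, Fintype.card_fin, hm, Nat.cast_max]
  have h2 : ((innovationOfNe (L + 1) nd ni (Fin.last L)).card : ℝ) = max (nd : ℝ) (ni : ℝ) - ni := by
    rw [innovationOfNe, if_pos (by simp), card_filter_le_val _ _ hni, hm, Nat.cast_max]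
  simp only [h1, h2, Finset.sum_const, Finset.card_univ, Fintype.card_fin, nsmul_eq_mul]
  push_cast
  ring

/-- If the innovation levels are also the rates of linear codes without error for cognition at the
last transmitter, then their total number is the sum-capacity. -/
lemma IsInnovation.sumCapacity {n : Fin K → Fin K → ℕ} {s : Fin K → Finset (Fin (levels n))}
    (hs : IsInnovation n s)
    (hc : ∀ N, ∃ c : Code n (lastOnly K)
      (fun i => Fin (N * Fintype.card {a // a ∈ s i}) → ZMod 2) N,
      c.IsLinear ∧ ∀ w l, c.dec l (c.received w l) = w l) :
    IsSumCapacity n (cms K) (∑ j, ((s j).card : ℝ)) ∧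
    IsSumCapacity n (lastOnly K) (∑ j, ((s j).card : ℝ)) ∧
    ∃ k : Fin K → ℕ, ∑ i, (k i : ℝ) = ∑ j, ((s j).card : ℝ) ∧
      (fun i => (k i : ℝ)) ∈ capacityRegion n (lastOnly K) ∧
      ∀ N : ℕ, ∃ c : Code n (lastOnly K) (fun i => Fin (N * k i) → ZMod 2) N,
        c.IsLinear ∧ c.errorProb = 0 := by
  have hsub : capacityRegion n (lastOnly K) ⊆ capacityRegion n (cms K) :=
    capacityRegion_mono lastOnly_subset_cms
  have hk : ∑ i, (Fintype.card {a // a ∈ s i} : ℝ) = ∑ j, ((s j).card : ℝ) := by simp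
  have hmem : (fun i => (Fintype.card {a // a ∈ s i} : ℝ)) ∈ capacityRegion n (lastOnly K) :=
    mem_capacityRegion_of_perfect_codes _ fun N => (hc N).imp fun c h => h.2
  refine ⟨⟨⟨_, hsub hmem, hk⟩, ?_⟩, ⟨⟨_, hmem, hk⟩, ?_⟩, _, hk, hmem,
    fun N => (hc N).imp fun c h => ⟨h.1, c.errorProb_eq_zero h.2⟩⟩
  · rintro _ ⟨R, hR, rfl⟩
    exact hs.sum_rate_le hR
  · rintro _ ⟨R, hR, rfl⟩
    exact hs.sum_rate_le (hsub hR)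

end Symmetric

end CIFC

theorem mainTheorem3 (K : ℕ) (hK : 2 ≤ K) (nd ni : ℕ) :
    ∃ C : ℝ,
      -- the outer bound, maximized over the input laws, is the sum-capacity
      CIFC.IsSumRateOuterBound (CIFC.symGain K nd ni) C ∧
      CIFC.IsSumCapacity (CIFC.symGain K nd ni) (CIFC.cms K) C ∧
      -- its value, and its value normalized by the direct gain
      C = (if nd = ni then (nd : ℝ) else (K : ℝ) * max (nd : ℝ) (ni : ℝ) - (ni : ℝ)) ∧
      (∀ α : ℝ, 0 < nd → (ni : ℝ) = α * (nd : ℝ) →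
        C / (nd : ℝ) = if α = 1 then 1 else (K : ℝ) * max 1 α - α) ∧
      -- it is already the sum-capacity when only transmitter `K` is cognitive, and it is then
      -- achieved by linear codes without error
      CIFC.IsSumCapacity (CIFC.symGain K nd ni) (CIFC.lastOnly K) C ∧
      ∃ k : Fin K → ℕ, ∑ i, (k i : ℝ) = C ∧
        (fun i => (k i : ℝ)) ∈
          CIFC.capacityRegion (CIFC.symGain K nd ni) (CIFC.lastOnly K) ∧
        ∀ N : ℕ,
          ∃ c : CIFC.Code (CIFC.symGain K nd ni) (CIFC.lastOnly K)
              (fun i => Fin (N * k i) → ZMod 2) N,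
            c.IsLinear ∧ c.errorProb = 0 := by
  have hval : ∀ C : ℝ,
      C = (if nd = ni then (nd : ℝ) else (K : ℝ) * max (nd : ℝ) (ni : ℝ) - (ni : ℝ)) →
      ∀ α : ℝ, 0 < nd → (ni : ℝ) = α * (nd : ℝ) →
        C / (nd : ℝ) = if α = 1 then 1 else (K : ℝ) * max 1 α - α := by
    intro C hC α hnd hα
    have hpos : (0 : ℝ) < nd := by exact_mod_cast hnd
    -- Since `nd > 0`, the case distinction on the gains is one on their ratio.
    have hiff : nd = ni ↔ α = 1 := by
      rw [← Nat.cast_inj (R := ℝ), hα, eq_comm, mul_eq_right₀ hpos.ne']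
    simp only [hiff] at hC
    rw [hC]
    split_ifs with h
    · exact div_self hpos.ne'
    · have hmax : max (nd : ℝ) (ni : ℝ) = max 1 α * nd := by
        rw [max_mul_of_nonneg _ _ hpos.le, one_mul, hα]
      rw [hmax, hα]
      field_simp
  rcases eq_or_ne nd ni with rfl | hne
  · have hs := CIFC.isInnovation_of_eq (nd := nd) hK
    have hC := CIFC.sum_card_innovationOfEq (nd := nd) hK
    obtain ⟨h1, h2, h3⟩ := hs.sumCapacity (CIFC.exists_codes_of_eq hK)
    have h0 := hs.isSumRateOuterBound
    rw [hC] at h0 h1 h2 h3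
    have hv : (nd : ℝ) = (if nd = nd then (nd : ℝ) else
        (K : ℝ) * max (nd : ℝ) (nd : ℝ) - (nd : ℝ)) := by rw [if_pos rfl]
    exact ⟨nd, h0, h1, hv, hval _ hv, h2, h3⟩
  · have hs := CIFC.isInnovation_of_ne hK hne
    have hC := CIFC.sum_card_innovationOfNe (nd := nd) (ni := ni) hK
    obtain ⟨h1, h2, h3⟩ := hs.sumCapacity (CIFC.exists_codes_of_ne hK hne)
    have h0 := hs.isSumRateOuterBound
    rw [hC] at h0 h1 h2 h3
    have hv : (K : ℝ) * max (nd : ℝ) (ni : ℝ) - ni = (if nd = ni then (nd : ℝ) else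
        (K : ℝ) * max (nd : ℝ) (ni : ℝ) - (ni : ℝ)) := by rw [if_neg hne]
    exact ⟨_, h0, h1, hv, hval _ hv, h2, h3⟩
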